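/- **Conventions.** For $\theta\in\mathbb R$ let $\log_\theta$ be the branch of the logarithm with imaginary part in $(\theta-\pi,\theta+\pi]$; its cut is the open ray $\{-te^{i\theta}:t>0\}$, and $\log_0$ is the principal branch. Choose real numbers $\theta_0,\theta_1,\theta_2,\dots$, all but finitely many equal to $0$. For $\alpha\in\mathbb C\setminus\{0,-1,-2,\dots\}$ let $$\zeta(s,\alpha)=\sum_{n\ge 0}(n+\alpha)^{-s},\qquad (n+\alpha)^{-s}=\exp\bigl(-s\log_{\theta_n}(n+\alpha)\bigr),$$ for $\operatorname{Re}s>1$, continued analytically in $s$ to $\mathbb C\setminus\{1\}$ (the continuation exists). Thus the $\theta_n$ select a branch in $\alpha$ of the Hurwitz zeta function; for $\theta_n=0$ all powers are principal. For $\operatorname{Re}s<0$ and $\alpha\in\{0,-1,-2,\dots\}$ put $\zeta(s,\alpha)=\lim_{\beta\to\alpha,\ \beta\ne\alpha}\zeta(s,\beta)$ when the limit exists. Let $\zeta^{(r)}(s,\alpha)=\partial_s^r\zeta(s,\alpha)$ for integers $r\ge 0$, and let $\zeta^{(r)}(s)$ be the $r$-th derivative of the Riemann zeta function. Say that $\alpha$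 is *off the cuts* if it lies on none of the open rays $\{-n-te^{i\theta_n}:t>0\}$, $n\ge 0$ (the end points $-n$ are not excluded as such). For every $\alpha\in\mathbb C$ the $\theta_n$ can be chosen with $|\theta_n|<\pi$ for all $n$ so that $\alpha$ is off the cuts. **Proposition.** For every choice of the $\theta_n$ as above and every integer $r\ge 0$: 0. If $\operatorname{Re}s<0$, then $\zeta^{(r)}(s,\cdot)$ is continuous at every $\alpha\in\mathbb C$ that is off the cuts, including such points among $0,-1,-2,\dots$. 1. If $|\theta_n|<\pi$ for all $n$ (so that $\log_{\theta_n}$ is real on the positive axis), then $\zeta^{(r)}(s,0)=\zeta^{(r)}(s)=\zeta^{(r)}(s,1)$ for $\operatorname{Re}s<0$, and $\lim_{s\to0^-}\zeta^{(r)}(s,0)=\zeta^{(r)}(0)$, where $s$ tends to $0$ through negative real values. 2. For $s\ne 0,1$ and every $\alpha\ne 0,-1,-2,\dots$ off the cuts, $$\frac{\partial}{\partial\alpha}\zeta^{(r)}(s,\alpha)=-r\,\zeta^{(r-1)}(s+1,\alpha)-s\,\zeta^{(r)}(s+1,\alpha),$$ where the first term on the right is $0$ if $r=0$. 3. For $\alpha\ne0,-1,-2,\dots$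 there is an expansion $s\,\zeta(s+1,\alpha)=\sum_{n\ge0}\gamma_{n-1}(\alpha)s^n$, valid for all $s\ne 0$, with $\gamma_{-1}(\alpha)=1$; and if moreover $\alpha$ is off the cuts, then $$\frac{\partial}{\partial\alpha}\zeta^{(r)}(0,\alpha)=-r!\,\gamma_{r-1}(\alpha).$$ 4. For $\alpha\ne0,-1,-2,\dots$ off the cuts, $$\frac{\partial}{\partial\alpha}\gamma_{r-1}(\alpha)=-\frac1{r!}\frac{\partial^2}{\partial\alpha^2}\zeta^{(r)}(0,\alpha)=-\frac1{r!}\,\frac{\partial^r}{\partial s^r}\Bigl(s(s+1)\zeta(s+2,\alpha)\Bigr)\Big|_{s=0}.$$ In 2–4 the existence of the derivatives is part of the claim. -/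

import Mathlib

open Filter Topology

noncomputable section

/-- The branch of the logarithm with imaginary part in `(θ - π, θ + π]`. Its cut is the ray
`{-t * exp (θ * I) | t > 0}`; `θ = 0` is the principal branch. -/
def branchLog (θ : ℝ) (z : ℂ) : ℂ :=
  Complex.log (z * Complex.exp (-(θ * Complex.I))) + θ * Complex.I

/-- `α` is one of `0, -1, -2, …`. -/
def IsNonposInt (α : ℂ) : Prop := ∃ n : ℕ, α = -(n : ℂ)

/-- For the branches `branchLog (θ n) (n + α)`, `n = 0, 1, 2, …`, the point `α` lies on none of the
open cut rays `{-n - t * exp (θ n * I) | t > 0}`; the end points `-n` themselves are allowed. -/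
def OffCuts (θ : ℕ →₀ ℝ) (α : ℂ) : Prop :=
  ∀ n : ℕ, (n : ℂ) + α = 0 ∨
    ((n : ℂ) + α) * Complex.exp (-(θ n * Complex.I)) ∈ Complex.slitPlane

/-- `F` is the analytic continuation, to all complex `s ≠ 1`, of `s ↦ ∑ (n + α) ^ (-s)`,
the `n`-th power being formed with the branch `branchLog (θ n)`. The value `F 1` plays no role. -/
def IsHurwitzContinuation (θ : ℕ →₀ ℝ) (α : ℂ) (F : ℂ → ℂ) : Prop :=
  DifferentiableOn ℂ F {1}ᶜ ∧
    ∀ s : ℂ, 1 < s.re →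
      HasSum (fun n : ℕ => Complex.exp (-s * branchLog (θ n) ((n : ℂ) + α))) (F s)

open scoped Classical in
/-- The Hurwitz zeta function for `α ≠ 0, -1, -2, …`. -/
def hurwitzBranchAux (θ : ℕ →₀ ℝ) (s α : ℂ) : ℂ :=
  if h : ∃ F : ℂ → ℂ, IsHurwitzContinuation θ α F then h.choose s else 0

open scoped Classical in
/-- The Hurwitz zeta function `ζ(s, α)` of two complex variables, for the choice `θ` of branches
of the powers `(n + α) ^ (-s)`. At `α = 0, -1, -2, …`, where the series is not defined, the value
is the limit of `ζ(s, β)` as `β → α` (used only for `Re s < 0`). -/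
def hurwitzBranch (θ : ℕ →₀ ℝ) (s α : ℂ) : ℂ :=
  if IsNonposInt α then limUnder (𝓝[≠] α) (fun β => hurwitzBranchAux θ s β)
  else hurwitzBranchAux θ s α

/-- `∂ ^ r / ∂ s ^ r` of `ζ(s, α)`. -/
def hurwitzBranchDeriv (θ : ℕ →₀ ℝ) (r : ℕ) (s α : ℂ) : ℂ :=
  iteratedDeriv r (fun w => hurwitzBranch θ w α) s

/-- `s * ζ(s + 1, α)` as a function of `s`, with its removable singularity at `s = 0` filled. -/
def shiftedHurwitz (θ : ℕ →₀ ℝ) (α : ℂ) : ℂ → ℂ :=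
  Function.update (fun s => s * hurwitzBranch θ (s + 1) α) 0
    (limUnder (𝓝[≠] (0 : ℂ)) (fun s => s * hurwitzBranch θ (s + 1) α))

/-- The coefficient of `s ^ n` in the power series of `s * ζ(s + 1, α)` at `s = 0`, that is,
`γ_{n-1}(α)`; so `hurwitzGamma θ 0 α` is `γ_{-1}(α)`. -/
def hurwitzGamma (θ : ℕ →₀ ℝ) (n : ℕ) (α : ℂ) : ℂ :=
  iteratedDeriv n (shiftedHurwitz θ α) 0 / (n.factorial : ℂ)

end

/-! Fix a disc `‖β‖ < K + 1` with `θ n = 0` for `n > K`. For `m > K` the power `(m + β) ^ (-s)` is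
principal and expands binomially in `β / m`. Summing over `m` first turns the tail of the Hurwitz
series into `∑ₖ binom(-s, k) β ^ k ζ_K(s + k)`, where `ζ_K` is `ζ` without its first `K` terms
(`hasSum_zetaTail_add_shiftSeries`). In the coefficient of `β ^ (k + 1)` the factor `s + k` cancels
the pole of `ζ_K(s + k + 1)`, so `ζ(s, β) = ζ(s) + hurwitzReg θ K s β` with the second term entire
in `s`. This one formula gives the continuation and is the working definition throughout.

Termwise differentiation in `β` gives `∂ζ(s, β)/∂β = -s ζ(s + 1, β)`, in a form in which the
singularity at `s = 0` is already removed (`hasDerivAt_hurwitzReg`). By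
`hasDerivAt_iteratedDeriv_param` the `r`-th derivative in `s` may be applied to both sides. For `s ≠
0` the Leibniz rule then gives claim 2; at `s = 0` the right side is a Taylor coefficient, which is
claim 3; a second differentiation gives claim 4.

Near `β = -n` only the power `(n + β) ^ (-s)` is singular. For `Re s < 0` it and its `s`-derivatives
tend to zero (`tendsto_branchPow_zero`), which gives continuity there and the value at `0`. -/

/-! ### Derivatives in a parameter -/

theorem TendstoLocallyUniformlyOn.iteratedDeriv_complex {ι : Type*} {φ : Filter ι} {U : Set ℂ}
    (hU : IsOpen U) (r : ℕ) {G : ι → ℂ → ℂ} {g : ℂ → ℂ}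
    (h : TendstoLocallyUniformlyOn G g φ U) (hG : ∀ᶠ i in φ, DifferentiableOn ℂ (G i) U) :
    TendstoLocallyUniformlyOn (fun i => iteratedDeriv r (G i)) (iteratedDeriv r g) φ U := by
  induction r generalizing G g with
  | zero => simpa [iteratedDeriv_zero] using h
  | succ r ih =>
    simp only [iteratedDeriv_succ']
    exact ih (h.deriv hG hU) (hG.mono fun i hi => hi.deriv hU)

/-- Differentiation in a parameter commutes with iterated complex differentiation. -/
theorem hasDerivAt_iteratedDeriv_param {U V : Set ℂ} (hU : IsOpen U) (hV : IsOpen V)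
    {F D : ℂ → ℂ → ℂ} (hF : ∀ β ∈ V, DifferentiableOn ℂ (fun s => F s β) U)
    (hD : ∀ s ∈ U, ∀ β ∈ V, HasDerivAt (F s) (D s β) β)
    (hc : ContinuousOn (fun p : ℂ × ℂ => D p.1 p.2) (U ×ˢ V)) (r : ℕ) {s α : ℂ}
    (hs : s ∈ U) (hα : α ∈ V) :
    HasDerivAt (fun β => iteratedDeriv r (fun w => F w β) s)
      (iteratedDeriv r (fun w => D w α) s) α := by
  have hVn : ∀ᶠ β in 𝓝[≠] α, β ∈ V := nhdsWithin_le_nhds (hV.mem_nhds hα)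
  -- Once the difference quotients in `β` converge locally uniformly in `w`, Weierstrass's theorem
  -- lets `iteratedDeriv r` pass to the limit.
  have key : TendstoLocallyUniformlyOn (fun β w => (β - α)⁻¹ * (F w β - F w α))
      (fun w => D w α) (𝓝[≠] α) U := by
    rw [Metric.tendstoLocallyUniformlyOn_iff]
    intro ε hε w hw
    have hca : ContinuousAt (fun p : ℂ × ℂ => D p.1 p.2) (w, α) :=
      hc.continuousAt ((hU.prod hV).mem_nhds ⟨hw, hα⟩)
    have h1 := Metric.continuousAt_iff.1 hca (ε / 4) (by positivity)
    obtain ⟨δ, hδ, h1⟩ := h1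
    obtain ⟨δ', hδ', hb⟩ := Metric.isOpen_iff.1 (hU.prod hV) (w, α) ⟨hw, hα⟩
    set η := min δ δ'
    have hη : 0 < η := lt_min hδ hδ'
    have hin : ∀ x ∈ Metric.ball w η, ∀ y ∈ Metric.ball α η, x ∈ U ∧ y ∈ V ∧
        dist (D x y) (D w α) < ε / 4 := by
      intro x hx y hy
      have hx' := Metric.mem_ball.1 hx
      have hy' := Metric.mem_ball.1 hy
      have hd : dist (x, y) (w, α) < η := by rw [Prod.dist_eq]; exact max_lt hx' hy'
      have := hb (Metric.mem_ball.2 (hd.trans_le (min_le_right _ _)))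
      exact ⟨this.1, this.2, h1 (hd.trans_le (min_le_left _ _))⟩
    refine ⟨Metric.ball w η, nhdsWithin_le_nhds (Metric.ball_mem_nhds w hη), ?_⟩
    have hnear : ∀ᶠ β in 𝓝[≠] α, β ∈ Metric.ball α η :=
      nhdsWithin_le_nhds (Metric.ball_mem_nhds α hη)
    filter_upwards [hnear, self_mem_nhdsWithin] with β hβ hne x hx
    have hne' : β - α ≠ 0 := sub_ne_zero.2 hne
    -- Mean value inequality for `F x y - D x α * y`, whose derivative `D x y - D x α` is below `ε /
    -- 4 + ε / 4` uniformly in `x`.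
    have hmv := (convex_ball α η).norm_image_sub_le_of_norm_hasDerivWithin_le
      (f := fun y => F x y - D x α * y) (f' := fun y => D x y - D x α) (C := ε / 2)
      (fun y hy => by
        have h := (hD x (hin x hx y hy).1 y (hin x hx y hy).2.1).fun_sub
          ((hasDerivAt_id y).const_mul (D x α))
        simpa using h.hasDerivWithinAt)
      (fun y hy => by
        rw [← dist_eq_norm]
        have h1 := (hin x hx y hy).2.2
        have h2 := (hin x hx α (Metric.mem_ball_self hη)).2.2
        have := dist_triangle_right (D x y) (D x α) (D w α)
        linarith) (Metric.mem_ball_self hη) hβ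
    have e : D x α - (β - α)⁻¹ * (F x β - F x α) =
        -((β - α)⁻¹ * ((F x β - D x α * β) - (F x α - D x α * α))) := by
      field_simp
      ring
    rw [dist_eq_norm, e, norm_neg, norm_mul, norm_inv]
    have hp : 0 < ‖β - α‖ := norm_pos_iff.2 hne'
    calc ‖β - α‖⁻¹ * _ ≤ ‖β - α‖⁻¹ * (ε / 2 * ‖β - α‖) := by gcongr
      _ = ε / 2 := by field_simp
      _ < ε := by linarith
  have hdiff : ∀ᶠ β in 𝓝[≠] α,
      DifferentiableOn ℂ (fun w => (β - α)⁻¹ * (F w β - F w α)) U := by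
    filter_upwards [hVn] with β hβ
    exact ((hF β hβ).sub (hF α hα)).const_mul _
  have h := (key.iteratedDeriv_complex hU r hdiff).tendsto_at hs
  rw [hasDerivAt_iff_tendsto_slope]
  refine h.congr' ?_
  filter_upwards [hVn] with β hβ
  have hcd : ∀ β ∈ V, ContDiffAt ℂ r (fun w => F w β) s := fun β hβ =>
    ((hF β hβ).analyticAt (hU.mem_nhds hs)).contDiffAt
  rw [iteratedDeriv_const_mul_field, iteratedDeriv_fun_sub (hcd β hβ) (hcd α hα), slope_def_field,
    div_eq_inv_mul]

/-! ### The binomial series -/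

/-- The binomial coefficient `-s` over `k`. -/
noncomputable def negBinom (k : ℕ) (s : ℂ) : ℂ :=
  (-1) ^ k * (∏ j ∈ Finset.range k, (s + j)) / (k.factorial : ℂ)

theorem negBinom_eq_choose (k : ℕ) (s : ℂ) : negBinom k s = Ring.choose (-s) k := by
  have h : (k.factorial : ℂ) ≠ 0 := by exact_mod_cast k.factorial_ne_zero
  rw [negBinom, div_eq_iff h, mul_comm _ (k.factorial : ℂ), ← nsmul_eq_mul,
    ← Ring.descPochhammer_eq_factorial_smul_choose]
  induction k with
  | zero => simp
  | succ k ih =>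
    have h : (k.factorial : ℂ) ≠ 0 := by exact_mod_cast k.factorial_ne_zero
    rw [descPochhammer_succ_right, Polynomial.smeval_mul, ← ih h, Finset.prod_range_succ]
    simp [pow_succ, Polynomial.smeval_natCast]
    ring

theorem hasSum_negBinom (s : ℂ) {x : ℂ} (hx : ‖x‖ < 1) :
    HasSum (fun k => negBinom k s * x ^ k) ((1 + x) ^ (-s)) := by
  have h := (Complex.one_add_cpow_hasFPowerSeriesOnBall_zero (a := -s)).hasSum (y := x)
    (by simpa [enorm_eq_nnnorm, ← NNReal.coe_lt_one] using hx)
  simpa [negBinom_eq_choose, binomialSeries, FormalMultilinearSeries.coeff_ofScalars, mul_comm]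
    using h

theorem summable_norm_negBinom (s : ℂ) {x : ℝ} (h0 : 0 ≤ x) (hx : x < 1) :
    Summable (fun k => ‖negBinom k s‖ * x ^ k) := by
  have h := (hasSum_negBinom s (x := (x : ℂ)) (by simpa [abs_of_nonneg h0] using hx)).summable.norm
  simpa [abs_of_nonneg h0] using h

/-- Factor by factor `‖s + j‖ ≤ R + j`, so convergence at the single point `R` gives a majorant for
the whole disc `‖s‖ ≤ R`. -/
theorem norm_negBinom_le (k : ℕ) {s : ℂ} {R : ℝ} (hs : ‖s‖ ≤ R) :
    ‖negBinom k s‖ ≤ ‖negBinom k (R : ℂ)‖ := by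
  have hR := (norm_nonneg s).trans hs
  simp only [negBinom, norm_div, norm_mul, norm_prod]
  gcongr with j
  calc ‖s + j‖ ≤ ‖s‖ + ‖(j : ℂ)‖ := norm_add_le _ _
    _ ≤ R + j := by simpa using hs
    _ = ‖(R : ℂ) + j‖ := by
      rw [← Complex.ofReal_natCast, ← Complex.ofReal_add, Complex.norm_real, Real.norm_of_nonneg]
      positivity

/-! ### The zeta function and its tails -/

theorem analyticAt_riemannZeta {s : ℂ} (hs : s ≠ 1) : AnalyticAt ℂ riemannZeta s := by
  have hd : DifferentiableOn ℂ riemannZeta {1}ᶜ := fun w hw =>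
    (differentiableAt_riemannZeta hw).differentiableWithinAt
  exact hd.analyticAt (isOpen_compl_singleton.mem_nhds hs)

/-- The entire function `(s - 1) ζ(s)`. -/
noncomputable def zetaEntire : ℂ → ℂ :=
  Function.update (fun s => (s - 1) * riemannZeta s) 1 1

theorem zetaEntire_of_ne {s : ℂ} (hs : s ≠ 1) : zetaEntire s = (s - 1) * riemannZeta s :=
  Function.update_of_ne hs _ _

theorem zetaEntire_one : zetaEntire 1 = 1 := Function.update_self _ _ _

theorem differentiable_zetaEntire : Differentiable ℂ zetaEntire := by
  rw [← differentiableOn_univ,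
    ← Complex.differentiableOn_compl_singleton_and_continuousAt_iff (c := 1) univ_mem]
  refine ⟨?_, continuousAt_update_same.2 riemannZeta_residue_one⟩
  refine DifferentiableOn.congr (f := fun s => (s - 1) * riemannZeta s) (fun s hs => ?_)
    fun s hs => zetaEntire_of_ne hs.2
  exact ((differentiableAt_id.sub_const 1).mul
    (differentiableAt_riemannZeta hs.2)).differentiableWithinAt

/-- The sum of the first `K` terms of the Dirichlet series of `ζ`. -/
noncomputable def zetaHead (K : ℕ) (s : ℂ) : ℂ := ∑ n ∈ Finset.range K, ((n : ℂ) + 1) ^ (-s)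

theorem differentiable_zetaHead (K : ℕ) : Differentiable ℂ (zetaHead K) := by
  unfold zetaHead
  refine Differentiable.fun_sum fun n _ => ?_
  exact fun s => differentiableAt_id.neg.const_cpow (Or.inl (Nat.cast_add_one_ne_zero n))

/-- `ζ` without the first `K` terms of its Dirichlet series. -/
noncomputable def zetaTail (K : ℕ) (s : ℂ) : ℂ := riemannZeta s - zetaHead K s

theorem hasSum_riemannZeta {s : ℂ} (hs : 1 < s.re) :
    HasSum (fun n : ℕ => ((n : ℂ) + 1) ^ (-s)) (riemannZeta s) := by
  have h1 : Summable (fun n : ℕ => 1 / ((n : ℂ) + 1) ^ s) := by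
    have := (summable_nat_add_iff 1).2 (Complex.summable_one_div_nat_cpow.2 hs)
    simpa using this
  have h := h1.hasSum
  rw [← zeta_eq_tsum_one_div_nat_add_one_cpow hs] at h
  simpa [Complex.cpow_neg] using h

theorem hasSum_zetaTail (K : ℕ) {s : ℂ} (hs : 1 < s.re) :
    HasSum (fun n : ℕ => ((n + K + 1 : ℕ) : ℂ) ^ (-s)) (zetaTail K s) := by
  have h := (hasSum_nat_add_iff (f := fun n : ℕ => ((n : ℂ) + 1) ^ (-s)) (g := zetaTail K s) K).2
    (by simpa [zetaTail, zetaHead] using hasSum_riemannZeta hs)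
  simpa using h

/-- The entire function `(s - 1) * zetaTail K s`. -/
noncomputable def zetaTailEntire (K : ℕ) (s : ℂ) : ℂ := zetaEntire s - (s - 1) * zetaHead K s

theorem zetaTailEntire_of_ne (K : ℕ) {s : ℂ} (hs : s ≠ 1) :
    zetaTailEntire K s = (s - 1) * zetaTail K s := by
  rw [zetaTailEntire, zetaEntire_of_ne hs, zetaTail]
  ring

theorem differentiable_zetaTailEntire (K : ℕ) : Differentiable ℂ (zetaTailEntire K) :=
  differentiable_zetaEntire.sub ((differentiable_id.sub_const 1).mul (differentiable_zetaHead K))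

/-! ### The power series in the shift -/

/-- The coefficient of `β ^ (k + 1)` in `ζ(s, K + 1 + β)`. -/
noncomputable def shiftCoeff (K k : ℕ) (s : ℂ) : ℂ :=
  (-1) ^ (k + 1) * (∏ j ∈ Finset.range k, (s + j)) / ((k + 1).factorial : ℂ) *
    zetaTailEntire K (s + k + 1)

theorem differentiable_shiftCoeff (K k : ℕ) : Differentiable ℂ (shiftCoeff K k) := by
  unfold shiftCoeff
  have := differentiable_zetaTailEntire K
  fun_prop

/-- The last factor `s + k` of the binomial coefficient is `(s + k + 1) - 1`, exactly what makes
`zetaTail` entire at `s + k + 1`. -/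
theorem shiftCoeff_eq (K k : ℕ) {s : ℂ} (hs : s + k ≠ 0) :
    shiftCoeff K k s = negBinom (k + 1) s * zetaTail K (s + k + 1) := by
  rw [shiftCoeff, zetaTailEntire_of_ne K (by simpa using hs), negBinom, Finset.prod_range_succ]
  ring

theorem shiftCoeff_zero (K : ℕ) (s : ℂ) : shiftCoeff K 0 s = -zetaTailEntire K (s + 1) := by
  simp [shiftCoeff]

/-- With this recursion the termwise derivative in `β` reproduces the series at `s + 1`. -/
theorem shiftCoeff_succ (K k : ℕ) (s : ℂ) :
    ((k : ℂ) + 2) * shiftCoeff K (k + 1) s = -s * shiftCoeff K k (s + 1) := by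
  have h1 : ((k + 1).factorial : ℂ) ≠ 0 := by exact_mod_cast (k + 1).factorial_ne_zero
  have h2 : (k : ℂ) + 2 ≠ 0 := by exact_mod_cast (k + 1).succ_ne_zero
  have h3 : ((k + 1 + 1).factorial : ℂ) = ((k : ℂ) + 2) * ((k + 1).factorial : ℂ) := by
    rw [Nat.factorial_succ]; push_cast; ring
  have h4 : ∏ j ∈ Finset.range (k + 1), (s + j) = s * ∏ j ∈ Finset.range k, (s + 1 + j) := by
    rw [Finset.prod_range_succ', mul_comm]
    refine congrArg₂ _ (by simp) (Finset.prod_congr rfl fun j _ => ?_)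
    push_cast
    ring
  have h5 : s + ((k + 1 : ℕ) : ℂ) + 1 = s + 1 + k + 1 := by push_cast; ring
  rw [shiftCoeff, shiftCoeff, h3, h4, h5]
  field_simp
  ring

/-- `ζ(s, K + 1 + β) - ζ(s, K + 1)` as a power series in `β`. -/
noncomputable def shiftSeries (K : ℕ) (s β : ℂ) : ℂ := ∑' k, shiftCoeff K k s * β ^ (k + 1)

/-- Every base `m` in the tail is at least `K + 1`. Splitting off `m ^ (-2)` for convergence leaves
a nonpositive exponent, so the rest is largest at `m = K + 1`. The decay `(K + 1) ^ (-k)` fixes the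
radius of convergence in `β`. -/
theorem norm_zetaTail_le (K : ℕ) :
    ∃ C : ℝ, ∀ (k : ℕ) (s : ℂ), 2 ≤ (s + k).re →
      ‖zetaTail K (s + k)‖ ≤ C * ((K : ℝ) + 1) ^ (2 - s.re) * (((K : ℝ) + 1) ^ k)⁻¹ := by
  have hsum : Summable (fun n : ℕ => ((n + K + 1 : ℕ) : ℝ) ^ (-2 : ℝ)) := by
    have := (summable_nat_add_iff (K + 1)).2 (Real.summable_nat_rpow.2 (by norm_num : (-2 : ℝ) < -1))
    simpa [add_assoc] using this
  refine ⟨∑' n : ℕ, ((n + K + 1 : ℕ) : ℝ) ^ (-2 : ℝ), fun k s hs => ?_⟩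
  have hK : (0 : ℝ) < (K : ℝ) + 1 := by positivity
  have h := (hasSum_zetaTail K (s := s + k) (by linarith)).tsum_eq
  rw [← h, mul_assoc, ← tsum_mul_right]
  refine tsum_of_norm_bounded (hsum.mul_right _).hasSum fun n => ?_
  have hn : (K : ℝ) + 1 ≤ ((n + K + 1 : ℕ) : ℝ) := by push_cast; linarith [n.cast_nonneg (α := ℝ)]
  have hn0 : (0 : ℝ) < ((n + K + 1 : ℕ) : ℝ) := hK.trans_le hn
  rw [Complex.norm_natCast_cpow_of_pos (by positivity)]
  have e1 : (-(s + k)).re = -2 + (2 - s.re - k) := by simp; ring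
  have e2 : ((K : ℝ) + 1) ^ (2 - s.re) * (((K : ℝ) + 1) ^ k)⁻¹ = ((K : ℝ) + 1) ^ (2 - s.re - k) := by
    rw [Real.rpow_sub hK _ (k : ℝ), Real.rpow_natCast, div_eq_mul_inv]
  rw [e1, e2, Real.rpow_add hn0]
  refine mul_le_mul_of_nonneg_left ?_ (by positivity)
  refine Real.rpow_le_rpow_of_nonpos hK hn ?_
  simp at hs
  linarith

theorem exists_summable_bound_shiftSeries (K : ℕ) (R : ℝ) {ρ : ℝ} (h0 : 0 ≤ ρ) (hρ : ρ < K + 1) :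
    ∃ u : ℕ → ℝ, Summable u ∧ ∀ k (s β : ℂ), ‖s‖ ≤ R → ‖β‖ ≤ ρ →
      ‖shiftCoeff K k s * β ^ (k + 1)‖ ≤ u k := by
  obtain ⟨C, hC⟩ := norm_zetaTail_le K
  have hK : (0 : ℝ) < (K : ℝ) + 1 := by positivity
  have hbd : ∀ k, ∃ B : ℝ, ∀ s : ℂ, ‖s‖ ≤ R → ‖shiftCoeff K k s‖ ≤ B := by
    intro k
    obtain ⟨B, hB⟩ := (isCompact_closedBall (0 : ℂ) R).exists_bound_of_continuousOn
      (differentiable_shiftCoeff K k).continuous.continuousOn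
    exact ⟨B, fun s hs => hB s (by simpa using hs)⟩
  choose B hB using hbd
  -- For `k ≥ k₀` and `‖s‖ ≤ R` this forces `Re (s + k + 1) ≥ 2`, inside the Dirichlet series bound.
  -- The finitely many smaller `k`, where the cancelled pole may lie, are bounded by compactness.
  obtain ⟨k₀, hk₀⟩ := exists_nat_ge (R + 1)
  set x := ρ / ((K : ℝ) + 1)
  have hx0 : 0 ≤ x := by positivity
  have hx1 : x < 1 := (div_lt_one hK).2 hρ
  set v : ℕ → ℝ := fun k => |C| * ((K : ℝ) + 1) ^ (2 + R) *
    (‖negBinom (k + 1) (R : ℂ)‖ * x ^ (k + 1)) with hv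
  have hvs : Summable v :=
    ((summable_nat_add_iff 1).2 (summable_norm_negBinom (R : ℂ) hx0 hx1)).mul_left _
  refine ⟨fun k => if k < k₀ then B k * ρ ^ (k + 1) else v k, ?_, fun k s β hs hβ => ?_⟩
  · refine (summable_nat_add_iff k₀).1 (((summable_nat_add_iff k₀).2 hvs).congr fun k => ?_)
    simp
  · simp only
    have hre : -R ≤ s.re := (neg_le_neg hs).trans (neg_le_of_abs_le (Complex.abs_re_le_norm s))
    rw [norm_mul, norm_pow]
    split_ifs with hk
    · have := hB k s hs
      have := (norm_nonneg _).trans this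
      gcongr
    · have hk' : (k₀ : ℝ) ≤ k := by exact_mod_cast not_lt.1 hk
      have hne : s + k ≠ 0 := fun h => by
        have := congrArg Complex.re h
        simp at this
        linarith
      have e : s + k + 1 = s + ((k + 1 : ℕ) : ℂ) := by push_cast; ring
      rw [shiftCoeff_eq K k hne, norm_mul, e]
      have h1 : ‖zetaTail K (s + ((k + 1 : ℕ) : ℂ))‖ ≤
          |C| * ((K : ℝ) + 1) ^ (2 + R) * (((K : ℝ) + 1) ^ (k + 1))⁻¹ := by
        refine (hC (k + 1) s (by simp; linarith)).trans ?_
        gcongr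
        · exact le_abs_self C
        · linarith [K.cast_nonneg (α := ℝ)]
        · linarith
      calc _ ≤ ‖negBinom (k + 1) (R : ℂ)‖ *
            (|C| * ((K : ℝ) + 1) ^ (2 + R) * (((K : ℝ) + 1) ^ (k + 1))⁻¹) * ρ ^ (k + 1) := by
            gcongr
            exact norm_negBinom_le _ hs
        _ = v k := by
            simp only [hv, x, div_pow]
            ring

theorem exists_norm_lt_lt {β : ℂ} {r : ℝ} (h : ‖β‖ < r) : ∃ ρ, ‖β‖ < ρ ∧ ρ < r ∧ 0 ≤ ρ := by
  obtain ⟨ρ, h1, h2⟩ := exists_between h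
  exact ⟨ρ, h1, h2, (norm_nonneg β).trans h1.le⟩

theorem summable_shiftSeries (K : ℕ) (s : ℂ) {β : ℂ} (hβ : ‖β‖ < K + 1) :
    Summable (fun k => shiftCoeff K k s * β ^ (k + 1)) := by
  obtain ⟨u, hu, h⟩ := exists_summable_bound_shiftSeries K ‖s‖ (norm_nonneg β) hβ
  exact Summable.of_norm_bounded hu fun k => h k s β le_rfl le_rfl

theorem differentiable_shiftSeries_left (K : ℕ) {β : ℂ} (hβ : ‖β‖ < K + 1) :
    Differentiable ℂ (fun s => shiftSeries K s β) := by
  intro s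
  obtain ⟨u, hu, h⟩ := exists_summable_bound_shiftSeries K (‖s‖ + 1) (norm_nonneg β) hβ
  have := Complex.differentiableOn_tsum_of_summable_norm (U := Metric.ball 0 (‖s‖ + 1)) hu
    (F := fun k s => shiftCoeff K k s * β ^ (k + 1))
    (fun k => ((differentiable_shiftCoeff K k).mul_const _).differentiableOn) Metric.isOpen_ball
    (fun k w hw => h k w β (by simpa using (Metric.mem_ball.1 hw).le) le_rfl)
  exact this.differentiableAt (Metric.isOpen_ball.mem_nhds (by simp))

theorem continuousOn_shiftSeries (K : ℕ) :
    ContinuousOn (fun p : ℂ × ℂ => shiftSeries K p.1 p.2)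
      (Set.univ ×ˢ Metric.ball 0 ((K : ℝ) + 1)) := by
  rintro ⟨s, β⟩ ⟨-, hβ⟩
  obtain ⟨ρ, h1, h2, h0⟩ := exists_norm_lt_lt (by simpa using hβ)
  obtain ⟨u, hu, h⟩ := exists_summable_bound_shiftSeries K (‖s‖ + 1) h0 h2
  have hc := continuousOn_tsum (s := Metric.ball (0 : ℂ) (‖s‖ + 1) ×ˢ Metric.ball (0 : ℂ) ρ)
    (f := fun k (p : ℂ × ℂ) => shiftCoeff K k p.1 * p.2 ^ (k + 1)) (u := u)
    (fun k => by
      have := (differentiable_shiftCoeff K k).continuous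
      fun_prop) hu
    (fun k p hp => h k _ _ (by simpa using (Metric.mem_ball.1 hp.1).le)
      (by simpa using (Metric.mem_ball.1 hp.2).le))
  exact (hc.continuousAt ((Metric.isOpen_ball.prod Metric.isOpen_ball).mem_nhds
    ⟨by simp, by simpa using h1⟩)).continuousWithinAt

theorem hasDerivAt_shiftSeries (K : ℕ) (s : ℂ) {β : ℂ} (hβ : ‖β‖ < K + 1) :
    HasDerivAt (shiftSeries K s) (-(zetaTailEntire K (s + 1) + s * shiftSeries K (s + 1) β)) β := by
  obtain ⟨ρ, h1, h2, h0⟩ := exists_norm_lt_lt hβ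
  obtain ⟨u, hu, h⟩ := exists_summable_bound_shiftSeries K ‖s‖ h0 h2
  have hU : IsOpen (Metric.ball (0 : ℂ) ρ) := Metric.isOpen_ball
  have hmem : β ∈ Metric.ball (0 : ℂ) ρ := by simpa using h1
  have hF : ∀ k : ℕ, DifferentiableOn ℂ (fun b => shiftCoeff K k s * b ^ (k + 1))
      (Metric.ball (0 : ℂ) ρ) := fun k => by fun_prop
  have hle : ∀ (k : ℕ) (b : ℂ), b ∈ Metric.ball (0 : ℂ) ρ →
      ‖shiftCoeff K k s * b ^ (k + 1)‖ ≤ u k := fun k b hb =>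
    h k s b le_rfl (by simpa using (Metric.mem_ball.1 hb).le)
  have hd := ((Complex.differentiableOn_tsum_of_summable_norm hu hF hU hle).differentiableAt
    (hU.mem_nhds hmem)).hasDerivAt
  have hs := Complex.hasSum_deriv_of_summable_norm hu hF hU hle hmem
  have hs' : HasSum (fun k : ℕ => deriv (fun b => shiftCoeff K k s * b ^ (k + 1)) β)
      (-(zetaTailEntire K (s + 1) + s * shiftSeries K (s + 1) β)) := by
    have h3 := ((summable_shiftSeries K (s + 1) hβ).hasSum).mul_left (-s)
    -- The term `k = 0` contributes `-zetaTailEntire K (s + 1)`; the others match by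
    -- `shiftCoeff_succ`.
    rw [← hasSum_nat_add_iff' 1]
    have hder : ∀ k : ℕ, deriv (fun b => shiftCoeff K k s * b ^ (k + 1)) β =
        ((k : ℂ) + 1) * shiftCoeff K k s * β ^ k := fun k => by
      rw [deriv_const_mul_field, deriv_pow_field]
      push_cast
      ring
    convert! h3 using 1
    · funext k
      rw [hder, pow_succ]
      have := shiftCoeff_succ K k s
      push_cast
      linear_combination (β ^ k * β) * this
    · rw [Finset.sum_range_one, hder, shiftCoeff_zero, shiftSeries]
      simp
  rw [hs.unique hs'] at hd
  exact hd

theorem exp_neg_mul_log_natCast_add {N : ℕ} (hN : N ≠ 0) (s : ℂ) {β : ℂ} (hβ : ‖β‖ < N) :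
    Complex.exp (-s * Complex.log (N + β)) = (N : ℂ) ^ (-s) * (1 + β / N) ^ (-s) := by
  have hN0 : (N : ℂ) ≠ 0 := Nat.cast_ne_zero.2 hN
  have hN' : (0 : ℝ) < N := by positivity
  have hx : ‖β / N‖ < 1 := by
    rw [norm_div, Complex.norm_natCast]
    exact (div_lt_one hN').2 hβ
  have h1 : 1 + β / N ≠ 0 := Complex.slitPlane_ne_zero (Complex.mem_slitPlane_of_norm_lt_one hx)
  have h2 : (N : ℂ) + β = ((N : ℝ) : ℂ) * (1 + β / N) := by
    push_cast
    field_simp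
  rw [h2, Complex.log_ofReal_mul hN' h1, Complex.cpow_def_of_ne_zero hN0,
    Complex.cpow_def_of_ne_zero h1, ← Complex.exp_add, ← Complex.natCast_log]
  congr 1
  ring

/-- Summation of one double series in two orders: over `k` it gives the shifted powers, over `n` the
zeta tails. Since every base is at least `K + 1`, the product of two convergent series, one in `n`
and one in powers of `‖β‖ / (K + 1)`, is a majorant. -/
theorem hasSum_zetaTail_add_shiftSeries (K : ℕ) {s β : ℂ} (hs : 1 < s.re) (hβ : ‖β‖ < K + 1) :
    HasSum (fun n : ℕ => Complex.exp (-s * Complex.log (((n + K + 1 : ℕ) : ℂ) + β)))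
      (zetaTail K s + shiftSeries K s β) := by
  have hK : (0 : ℝ) < (K : ℝ) + 1 := by positivity
  set x := ‖β‖ / ((K : ℝ) + 1)
  have hx0 : 0 ≤ x := by positivity
  have hx1 : x < 1 := (div_lt_one hK).2 hβ
  set f : ℕ × ℕ → ℂ := fun p => ((p.1 + K + 1 : ℕ) : ℂ) ^ (-s) *
    (negBinom p.2 s * (β / ((p.1 + K + 1 : ℕ) : ℂ)) ^ p.2) with hf
  have hle : ∀ n : ℕ, (K : ℝ) + 1 ≤ ((n + K + 1 : ℕ) : ℝ) := fun n => by
    push_cast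
    linarith [n.cast_nonneg (α := ℝ)]
  have hsum : Summable f := by
    have h := Summable.mul_of_nonneg (hasSum_zetaTail K hs).summable.norm
      (summable_norm_negBinom s hx0 hx1) (fun _ => norm_nonneg _) (fun _ => by positivity)
    refine Summable.of_norm_bounded (g := fun p : ℕ × ℕ => ‖((p.1 + K + 1 : ℕ) : ℂ) ^ (-s)‖ *
      (‖negBinom p.2 s‖ * x ^ p.2)) h ?_
    rintro ⟨n, k⟩
    simp only [hf, norm_mul, norm_pow, norm_div, Complex.norm_natCast, x]
    gcongr
    exact hle n
  have h1 : ∀ n, HasSum (fun k => f (n, k))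
      (Complex.exp (-s * Complex.log (((n + K + 1 : ℕ) : ℂ) + β))) := fun n => by
    have hn : ‖β‖ < ((n + K + 1 : ℕ) : ℝ) := hβ.trans_le (hle n)
    rw [exp_neg_mul_log_natCast_add (by omega) s hn]
    have hx : ‖β / ((n + K + 1 : ℕ) : ℂ)‖ < 1 := by
      rw [norm_div, Complex.norm_natCast]
      exact (div_lt_one (hK.trans_le (hle n))).2 hn
    exact (hasSum_negBinom s hx).mul_left (((n + K + 1 : ℕ) : ℂ) ^ (-s))
  have h2 : ∀ k, HasSum (fun n => f (n, k)) (negBinom k s * β ^ k * zetaTail K (s + k)) :=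
    fun k => by
    have h := (hasSum_zetaTail K (s := s + k)
      (by simpa using add_lt_add_of_lt_of_le hs k.cast_nonneg)).mul_left (negBinom k s * β ^ k)
    convert! h using 1
    funext n
    have hn : ((n + K + 1 : ℕ) : ℂ) ≠ 0 := Nat.cast_ne_zero.2 (by omega)
    simp only [hf]
    rw [neg_add, Complex.cpow_add _ _ hn, Complex.cpow_neg _ (k : ℂ), Complex.cpow_natCast, div_pow]
    ring
  have h3 := hsum.hasSum.prod_fiberwise h1
  have h4 : HasSum (fun k => negBinom k s * β ^ k * zetaTail K (s + k)) (∑' p, f p) :=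
    HasSum.prod_fiberwise (f := fun p : ℕ × ℕ => f (p.2, p.1))
      ((Equiv.prodComm ℕ ℕ).hasSum_iff.2 hsum.hasSum) h2
  have h5 : HasSum (fun k => negBinom k s * β ^ k * zetaTail K (s + k))
      (zetaTail K s + shiftSeries K s β) := by
    rw [← hasSum_nat_add_iff' 1]
    convert! (summable_shiftSeries K s hβ).hasSum using 1
    · funext k
      rw [shiftCoeff_eq K k]
      · push_cast
        rw [add_assoc s]
        ring
      · intro h
        have := congrArg Complex.re h
        simp at this
        linarith [k.cast_nonneg (α := ℝ)]
    · simp [negBinom, shiftSeries]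
  rw [h4.unique h5] at h3
  exact h3

/-! ### Branches of the logarithm and of powers -/

theorem exp_branchLog (θ : ℝ) {z : ℂ} (hz : z ≠ 0) : Complex.exp (branchLog θ z) = z := by
  rw [branchLog, Complex.exp_add, Complex.exp_log (mul_ne_zero hz (Complex.exp_ne_zero _)),
    mul_assoc, ← Complex.exp_add]
  simp

theorem branchLog_zero (z : ℂ) : branchLog 0 z = Complex.log z := by simp [branchLog]

theorem hasDerivAt_branchLog {θ : ℝ} {z : ℂ}
    (hz : z * Complex.exp (-(θ * Complex.I)) ∈ Complex.slitPlane) :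
    HasDerivAt (branchLog θ) z⁻¹ z := by
  have h := (((hasDerivAt_id z).mul_const (Complex.exp (-(θ * Complex.I)))).clog hz).add_const
    ((θ : ℂ) * Complex.I)
  convert! h using 1
  have := Complex.exp_ne_zero (-(θ * Complex.I))
  simp only [one_mul, id]
  rw [div_mul_cancel_right₀ this]

theorem re_branchLog (θ : ℝ) (z : ℂ) : (branchLog θ z).re = Real.log ‖z‖ := by
  have : ‖Complex.exp (-((θ : ℂ) * Complex.I))‖ = 1 := by
    rw [← neg_mul, ← Complex.ofReal_neg, Complex.norm_exp_ofReal_mul_I]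
  simp [branchLog, Complex.log_re, this]

theorem abs_im_branchLog_le (θ : ℝ) (z : ℂ) : |(branchLog θ z).im| ≤ Real.pi + |θ| := by
  have h : (branchLog θ z).im = (z * Complex.exp (-(θ * Complex.I))).arg + θ := by
    simp [branchLog, Complex.log_im]
  rw [h]
  exact (abs_add_le _ _).trans (add_le_add_left (Complex.abs_arg_le_pi _) _)

/-- The `r`-th derivative in `s` of `z ^ (-s)`, formed with `branchLog θ`; zero at `z = 0`. -/
noncomputable def branchPow (θ : ℝ) (r : ℕ) (s z : ℂ) : ℂ :=
  if z = 0 then 0 else (-branchLog θ z) ^ r * Complex.exp (-s * branchLog θ z)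

theorem branchPow_zero_of_ne (θ : ℝ) (s : ℂ) {z : ℂ} (hz : z ≠ 0) :
    branchPow θ 0 s z = Complex.exp (-s * branchLog θ z) := by
  simp [branchPow, hz]

theorem differentiable_branchPow (θ : ℝ) (r : ℕ) (z : ℂ) :
    Differentiable ℂ (fun s => branchPow θ r s z) := by
  unfold branchPow
  split_ifs <;> fun_prop

theorem iteratedDeriv_branchPow (θ : ℝ) (r : ℕ) (s z : ℂ) :
    iteratedDeriv r (fun w => branchPow θ 0 w z) s = branchPow θ r s z := by
  unfold branchPow
  split_ifs with hz
  · simp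
  · have : (fun w => (-branchLog θ z) ^ 0 * Complex.exp (-w * branchLog θ z)) =
        fun w => Complex.exp (-branchLog θ z * w) := by
      funext w
      rw [pow_zero, one_mul]
      congr 1
      ring
    rw [this, iteratedDeriv_cexp_const_mul]
    beta_reduce
    rw [show -branchLog θ z * s = -s * branchLog θ z by ring]

theorem hasDerivAt_branchPow {θ : ℝ} (s : ℂ) {z : ℂ}
    (hz : z * Complex.exp (-(θ * Complex.I)) ∈ Complex.slitPlane) :
    HasDerivAt (branchPow θ 0 s) (-s * branchPow θ 0 (s + 1) z) z := by
  have hz0 : z ≠ 0 := left_ne_zero_of_mul (Complex.slitPlane_ne_zero hz)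
  have h := ((hasDerivAt_branchLog hz).const_mul (-s)).cexp
  have h' : HasDerivAt (fun z => Complex.exp (-s * branchLog θ z))
      (-s * branchPow θ 0 (s + 1) z) z := by
    convert! h using 1
    rw [branchPow_zero_of_ne θ _ hz0, neg_add, add_mul, Complex.exp_add, neg_one_mul,
      Complex.exp_neg (branchLog θ z), exp_branchLog θ hz0]
    ring
  refine h'.congr_of_eventuallyEq ?_
  filter_upwards [isOpen_ne.mem_nhds hz0] with w hw
  exact branchPow_zero_of_ne θ s hw

/-- The imaginary part of the logarithm is bounded by `C`, so with `y = C - log ‖z‖ → ∞` the norm is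
at most a constant times `y ^ r * exp (s.re * y)`, and the exponential wins. -/
theorem tendsto_branchPow_zero (θ : ℝ) (r : ℕ) {s : ℂ} (hs : s.re < 0) :
    Tendsto (branchPow θ r s) (𝓝 0) (𝓝 0) := by
  set C := Real.pi + |θ| with hC
  have hC0 : 0 ≤ C := by positivity
  have hb : 0 < -s.re := neg_pos.2 hs
  have hy : Tendsto (fun z : ℂ => C - Real.log ‖z‖) (𝓝[≠] 0) atTop := by
    have h1 : Tendsto (fun z : ℂ => Real.log ‖z‖) (𝓝[≠] 0) atBot :=
      Real.tendsto_log_nhdsGT_zero.comp tendsto_norm_nhdsNE_zero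
    exact tendsto_atTop_add_const_left _ C (tendsto_neg_atBot_atTop.comp h1)
  have hlim : Tendsto (fun z : ℂ => Real.exp (-s.re * C + |s.im| * C) *
      ((C - Real.log ‖z‖) ^ r / Real.exp (-s.re * (C - Real.log ‖z‖)))) (𝓝[≠] 0) (𝓝 0) := by
    have := ((isLittleO_pow_exp_pos_mul_atTop r hb).tendsto_div_nhds_zero.comp hy).const_mul
      (Real.exp (-s.re * C + |s.im| * C))
    simpa using this
  have h0 : branchPow θ r s 0 = 0 := if_pos rfl
  have hne : Tendsto (branchPow θ r s) (𝓝[≠] 0) (𝓝 0) := by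
    refine squeeze_zero_norm' ?_ hlim
    have hnear : ∀ᶠ z : ℂ in 𝓝[≠] 0, ‖z‖ < 1 := by
      refine nhdsWithin_le_nhds ?_
      filter_upwards [Metric.ball_mem_nhds (0 : ℂ) one_pos] with z hz using by simpa using hz
    filter_upwards [hnear, self_mem_nhdsWithin] with z hz1 hz0
    have hz0 : z ≠ 0 := hz0
    have hlog : Real.log ‖z‖ ≤ 0 := Real.log_nonpos (norm_nonneg z) hz1.le
    have him := abs_im_branchLog_le θ z
    have hL : ‖branchLog θ z‖ ≤ C - Real.log ‖z‖ := by
      refine (Complex.norm_le_abs_re_add_abs_im _).trans ?_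
      rw [re_branchLog, abs_of_nonpos hlog]
      linarith
    have hre : (-s * branchLog θ z).re ≤ -s.re * Real.log ‖z‖ + |s.im| * C := by
      rw [Complex.mul_re, re_branchLog, Complex.neg_re, Complex.neg_im]
      have : s.im * (branchLog θ z).im ≤ |s.im| * C := by
        refine (le_abs_self _).trans ?_
        rw [abs_mul]
        gcongr
      linarith
    have hpow : 0 ≤ (C - Real.log ‖z‖) ^ r := pow_nonneg (by linarith) r
    rw [branchPow, if_neg hz0, norm_mul, norm_pow, norm_neg, Complex.norm_exp]
    calc _ ≤ (C - Real.log ‖z‖) ^ r * Real.exp (-s.re * Real.log ‖z‖ + |s.im| * C) := by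
          gcongr
      _ = _ := by
          rw [mul_div_left_comm, ← Real.exp_sub]
          congr 2
          ring
  have hc : ContinuousAt (branchPow θ r s) 0 :=
    continuousAt_iff_punctured_nhds.2 (by rwa [h0])
  rwa [ContinuousAt, h0] at hc

theorem continuousAt_branchPow {θ : ℝ} (r : ℕ) {s : ℂ} (hs : s.re < 0) {z : ℂ}
    (hz : z = 0 ∨ z * Complex.exp (-(θ * Complex.I)) ∈ Complex.slitPlane) :
    ContinuousAt (branchPow θ r s) z := by
  rcases hz with rfl | hz
  · have h0 : branchPow θ r s 0 = 0 := if_pos rfl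
    rw [ContinuousAt, h0]
    exact tendsto_branchPow_zero θ r hs
  · have hz0 : z ≠ 0 := left_ne_zero_of_mul (Complex.slitPlane_ne_zero hz)
    have hc := (hasDerivAt_branchLog hz).continuousAt
    have h : ContinuousAt
        (fun z => (-branchLog θ z) ^ r * Complex.exp (-s * branchLog θ z)) z := by fun_prop
    refine h.congr ?_
    filter_upwards [isOpen_ne.mem_nhds hz0] with w hw
    exact (if_neg hw).symm

/-! ### The regular part of the Hurwitz zeta function -/

/-- `ζ(s, β) - ζ(s)` for `‖β‖ < K + 1` and `θ n = 0` for `n > K`. -/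
noncomputable def hurwitzReg (θ : ℕ →₀ ℝ) (K : ℕ) (s β : ℂ) : ℂ :=
  ∑ n ∈ Finset.range (K + 1), branchPow (θ n) 0 s (n + β) - zetaHead K s + shiftSeries K s β

/-- The part of the disc `‖β‖ < K + 1` where no `n + β` with `n ≤ K` is zero or on its cut. -/
def regularDisc (θ : ℕ →₀ ℝ) (K : ℕ) : Set ℂ :=
  Metric.ball 0 ((K : ℝ) + 1) ∩ ⋂ n ∈ Finset.range (K + 1),
    (fun β : ℂ => ((n : ℂ) + β) * Complex.exp (-(θ n * Complex.I))) ⁻¹' Complex.slitPlane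

theorem isOpen_regularDisc (θ : ℕ →₀ ℝ) (K : ℕ) : IsOpen (regularDisc θ K) := by
  refine Metric.isOpen_ball.inter (isOpen_biInter_finset fun n _ => ?_)
  exact Complex.isOpen_slitPlane.preimage (by fun_prop)

theorem norm_lt_of_mem_regularDisc {θ : ℕ →₀ ℝ} {K : ℕ} {β : ℂ} (h : β ∈ regularDisc θ K) :
    ‖β‖ < (K : ℝ) + 1 := by simpa using h.1

theorem mem_slitPlane_of_mem_regularDisc {θ : ℕ →₀ ℝ} {K : ℕ} {β : ℂ} (h : β ∈ regularDisc θ K)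
    {n : ℕ} (hn : n ∈ Finset.range (K + 1)) :
    ((n : ℂ) + β) * Complex.exp (-(θ n * Complex.I)) ∈ Complex.slitPlane :=
  Set.mem_iInter₂.1 h.2 n hn

theorem not_isNonposInt_of_mem_regularDisc {θ : ℕ →₀ ℝ} {K : ℕ} {β : ℂ}
    (h : β ∈ regularDisc θ K) : ¬ IsNonposInt β := by
  rintro ⟨m, rfl⟩
  have h1 := norm_lt_of_mem_regularDisc h
  rw [norm_neg, Complex.norm_natCast] at h1
  have h2 := mem_slitPlane_of_mem_regularDisc h (n := m) (Finset.mem_range.2 (by exact_mod_cast h1))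
  exact Complex.slitPlane_ne_zero h2 (by simp)

theorem OffCuts.mem_regularDisc {θ : ℕ →₀ ℝ} {K : ℕ} {α : ℂ} (h : OffCuts θ α)
    (hα : ¬ IsNonposInt α) (hK : ‖α‖ < (K : ℝ) + 1) : α ∈ regularDisc θ K := by
  refine ⟨by simpa using hK, Set.mem_iInter₂.2 fun n _ => (h n).resolve_left fun h0 => ?_⟩
  exact hα ⟨n, by linear_combination h0⟩

theorem differentiable_hurwitzReg (θ : ℕ →₀ ℝ) (K : ℕ) {β : ℂ} (hβ : ‖β‖ < (K : ℝ) + 1) :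
    Differentiable ℂ (fun s => hurwitzReg θ K s β) :=
  ((Differentiable.fun_sum fun n _ => differentiable_branchPow (θ n) 0 (n + β)).fun_sub
    (differentiable_zetaHead K)).fun_add (differentiable_shiftSeries_left K hβ)

/-- The term `s * zetaHead K (s + 1)` hidden in `zetaTailEntire` is the head subtracted in
`hurwitzReg`, so the tail function becomes `zetaEntire`. -/
theorem hasDerivAt_hurwitzReg (θ : ℕ →₀ ℝ) (K : ℕ) (s : ℂ) {β : ℂ} (hβ : β ∈ regularDisc θ K) :
    HasDerivAt (hurwitzReg θ K s) (-(zetaEntire (s + 1) + s * hurwitzReg θ K (s + 1) β)) β := by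
  have h1 : HasDerivAt (fun b => ∑ n ∈ Finset.range (K + 1), branchPow (θ n) 0 s (n + b))
      (∑ n ∈ Finset.range (K + 1), -s * branchPow (θ n) 0 (s + 1) (n + β)) β :=
    HasDerivAt.fun_sum fun n hn =>
      (hasDerivAt_branchPow s (mem_slitPlane_of_mem_regularDisc hβ hn)).comp_const_add _ _
  have h := (h1.sub_const (zetaHead K s)).fun_add
    (hasDerivAt_shiftSeries K s (norm_lt_of_mem_regularDisc hβ))
  convert! h using 1
  rw [← Finset.mul_sum, zetaTailEntire, hurwitzReg]
  ring

theorem continuousOn_hurwitzReg (θ : ℕ →₀ ℝ) (K : ℕ) :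
    ContinuousOn (fun p : ℂ × ℂ => hurwitzReg θ K p.1 p.2) (Set.univ ×ˢ regularDisc θ K) := by
  refine ContinuousOn.add (ContinuousOn.sub (continuousOn_finsetSum _ fun n hn => ?_)
    ((differentiable_zetaHead K).continuous.comp continuous_fst).continuousOn)
    ((continuousOn_shiftSeries K).mono (Set.prod_mono_right Set.inter_subset_left))
  have hl : ContinuousOn (fun p : ℂ × ℂ => branchLog (θ n) (n + p.2))
      (Set.univ ×ˢ regularDisc θ K) := fun p hp => by
    have h1 := (hasDerivAt_branchLog (mem_slitPlane_of_mem_regularDisc hp.2 hn)).continuousAt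
    have h2 : ContinuousAt (fun p : ℂ × ℂ => (n : ℂ) + p.2) p := by fun_prop
    exact (ContinuousAt.comp (f := fun p : ℂ × ℂ => (n : ℂ) + p.2) h1 h2).continuousWithinAt
  refine ContinuousOn.congr (f := fun p => Complex.exp (-p.1 * branchLog (θ n) (n + p.2)))
    (by fun_prop) fun p hp => ?_
  exact branchPow_zero_of_ne _ _ (left_ne_zero_of_mul
    (Complex.slitPlane_ne_zero (mem_slitPlane_of_mem_regularDisc hp.2 hn)))

/-- The shift series is holomorphic in `β` on the whole disc. Only the finitely many branch powers
need the cuts avoided, and `Re s < 0` handles their end points. -/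
theorem continuousAt_iteratedDeriv_hurwitzReg (θ : ℕ →₀ ℝ) (K r : ℕ) {s α : ℂ} (hs : s.re < 0)
    (hα : OffCuts θ α) (hK : ‖α‖ < (K : ℝ) + 1) :
    ContinuousAt (fun β => iteratedDeriv r (fun w => hurwitzReg θ K w β) s) α := by
  have hball : Metric.ball (0 : ℂ) ((K : ℝ) + 1) ∈ 𝓝 α :=
    Metric.isOpen_ball.mem_nhds (by simpa using hK)
  have hZ := (differentiable_zetaTailEntire K).continuous
  have h1 : ContinuousAt (fun β => iteratedDeriv r (fun w => shiftSeries K w β) s) α := by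
    refine (hasDerivAt_iteratedDeriv_param (U := Set.univ)
      (V := Metric.ball (0 : ℂ) ((K : ℝ) + 1))
      (D := fun s β => -(zetaTailEntire K (s + 1) + s * shiftSeries K (s + 1) β))
      isOpen_univ Metric.isOpen_ball
      (fun β hβ => (differentiable_shiftSeries_left K (by simpa using hβ)).differentiableOn)
      (fun s _ β hβ => hasDerivAt_shiftSeries K s (by simpa using hβ)) ?_ r (Set.mem_univ s)
      (by simpa using hK)).continuousAt
    have hc : ContinuousOn (fun p : ℂ × ℂ => shiftSeries K (p.1 + 1) p.2)
        (Set.univ ×ˢ Metric.ball 0 ((K : ℝ) + 1)) :=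
      (continuousOn_shiftSeries K).comp (f := fun p : ℂ × ℂ => (p.1 + 1, p.2))
        (by fun_prop) fun p hp => ⟨Set.mem_univ _, hp.2⟩
    fun_prop
  have h2 : ContinuousAt (fun β =>
      ∑ n ∈ Finset.range (K + 1), branchPow (θ n) r s (n + β)) α := by
    refine tendsto_finsetSum _ fun n _ => ?_
    exact ContinuousAt.comp (f := fun β : ℂ => (n : ℂ) + β) (continuousAt_branchPow r hs (hα n))
      (by fun_prop)
  refine ((h2.fun_sub (continuousAt_const (y := iteratedDeriv r (zetaHead K) s))).fun_add
    h1).congr ?_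
  filter_upwards [hball] with β hβ
  have hcd : ∀ {f : ℂ → ℂ}, Differentiable ℂ f → ContDiffAt ℂ r f s := fun hf =>
    hf.contDiff.contDiffAt
  have hd : ∀ n : ℕ, Differentiable ℂ fun w => branchPow (θ n) 0 w (n + β) :=
    fun n => differentiable_branchPow (θ n) 0 (n + β)
  have hsum : Differentiable ℂ fun w =>
      ∑ n ∈ Finset.range (K + 1), branchPow (θ n) 0 w (n + β) :=
    Differentiable.fun_sum fun n _ => hd n
  have hE := differentiable_shiftSeries_left K (β := β) (by simpa using hβ)
  unfold hurwitzReg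
  rw [iteratedDeriv_fun_add (hcd (hsum.fun_sub (differentiable_zetaHead K))) (hcd hE),
    iteratedDeriv_fun_sub (hcd hsum) (hcd (differentiable_zetaHead K)),
    iteratedDeriv_fun_sum fun n _ => hcd (hd n)]
  simp only [iteratedDeriv_branchPow]

/-! ### Existence and uniqueness of the continuation -/

theorem IsHurwitzContinuation.eqOn {θ : ℕ →₀ ℝ} {α : ℂ} {F G : ℂ → ℂ}
    (hF : IsHurwitzContinuation θ α F) (hG : IsHurwitzContinuation θ α G) :
    Set.EqOn F G {1}ᶜ := by
  have ho : IsOpen ({1}ᶜ : Set ℂ) := isOpen_compl_singleton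
  refine (hF.1.analyticOnNhd ho).eqOn_of_preconnected_of_eventuallyEq (hG.1.analyticOnNhd ho)
    (isConnected_compl_singleton_of_one_lt_rank (by simp) _).isPreconnected
    (z₀ := 2) (by simp) ?_
  have h2 : {s : ℂ | 1 < s.re} ∈ 𝓝 (2 : ℂ) :=
    (isOpen_lt continuous_const Complex.continuous_re).mem_nhds (by simp)
  filter_upwards [h2] with s hs
  exact (hF.2 s hs).unique (hG.2 s hs)

theorem isHurwitzContinuation_riemannZeta_add {θ : ℕ →₀ ℝ} {K : ℕ} (hθ : ∀ n, K < n → θ n = 0)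
    {β : ℂ} (hβ : ‖β‖ < (K : ℝ) + 1) (hn : ¬ IsNonposInt β) :
    IsHurwitzContinuation θ β (fun s => riemannZeta s + hurwitzReg θ K s β) := by
  refine ⟨fun s hs => ((differentiableAt_riemannZeta hs).add
    (differentiable_hurwitzReg θ K hβ s)).differentiableWithinAt, fun s hs => ?_⟩
  have h := hasSum_zetaTail_add_shiftSeries K hs hβ
  rw [← hasSum_nat_add_iff' (K + 1)]
  have hsum : ∑ n ∈ Finset.range (K + 1), Complex.exp (-s * branchLog (θ n) ((n : ℂ) + β)) =
      ∑ n ∈ Finset.range (K + 1), branchPow (θ n) 0 s (n + β) :=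
    Finset.sum_congr rfl fun n _ => (branchPow_zero_of_ne _ _ fun h0 =>
      hn ⟨n, by linear_combination h0⟩).symm
  convert! h using 1
  · funext n
    rw [hθ _ (by omega), branchLog_zero, add_assoc n]
  · simp only [hsum, hurwitzReg, zetaTail]
    ring

theorem hurwitzBranchAux_eq {θ : ℕ →₀ ℝ} {K : ℕ} (hθ : ∀ n, K < n → θ n = 0)
    {s β : ℂ} (hs : s ≠ 1) (hβ : ‖β‖ < (K : ℝ) + 1) (hn : ¬ IsNonposInt β) :
    hurwitzBranchAux θ s β = riemannZeta s + hurwitzReg θ K s β := by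
  have hc := isHurwitzContinuation_riemannZeta_add hθ hβ hn
  have h : ∃ F : ℂ → ℂ, IsHurwitzContinuation θ β F := ⟨_, hc⟩
  rw [hurwitzBranchAux, dif_pos h]
  exact h.choose_spec.eqOn hc hs

theorem hurwitzBranch_eq {θ : ℕ →₀ ℝ} {K : ℕ} (hθ : ∀ n, K < n → θ n = 0)
    {s β : ℂ} (hs : s ≠ 1) (hβ : ‖β‖ < (K : ℝ) + 1) (hn : ¬ IsNonposInt β) :
    hurwitzBranch θ s β = riemannZeta s + hurwitzReg θ K s β := by
  rw [hurwitzBranch, if_neg hn, hurwitzBranchAux_eq hθ hs hβ hn]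

theorem eventually_not_isNonposInt (α : ℂ) : ∀ᶠ β in 𝓝[≠] α, ¬ IsNonposInt β := by
  obtain ⟨N, hN⟩ := exists_nat_gt ‖α‖
  have hball : Metric.ball (0 : ℂ) N ∈ 𝓝 α := Metric.isOpen_ball.mem_nhds (by simpa using hN)
  have hfin : ((fun n : ℕ => -(n : ℂ)) '' Set.Iio N \ {α})ᶜ ∈ 𝓝 α :=
    ((Set.finite_Iio N).image _).sdiff.isClosed.compl_mem_nhds fun h => h.2 rfl
  filter_upwards [nhdsWithin_le_nhds hball, nhdsWithin_le_nhds hfin, self_mem_nhdsWithin]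
    with β h1 h2 h3
  rintro ⟨n, rfl⟩
  refine h2 ⟨⟨n, ?_, rfl⟩, h3⟩
  simpa using h1

theorem hurwitzBranch_eq_of_re_neg {θ : ℕ →₀ ℝ} {K : ℕ} (hθ : ∀ n, K < n → θ n = 0)
    {s β : ℂ} (hs : s.re < 0) (hβ : ‖β‖ < (K : ℝ) + 1) (hc : OffCuts θ β) :
    hurwitzBranch θ s β = riemannZeta s + hurwitzReg θ K s β := by
  have hs1 : s ≠ 1 := fun h => by norm_num [h] at hs
  by_cases hn : IsNonposInt β
  · rw [hurwitzBranch, if_pos hn]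
    -- The convention `branchPow θ r s 0 = 0` agrees with the limit, so the formula extends to `β =
    -- -n` by continuity.
    refine Tendsto.limUnder_eq ?_
    have h := (continuousAt_iteratedDeriv_hurwitzReg θ K 0 hs hc hβ)
    simp only [iteratedDeriv_zero] at h
    refine ((h.const_add (riemannZeta s)).mono_left nhdsWithin_le_nhds).congr' ?_
    have hball : Metric.ball (0 : ℂ) ((K : ℝ) + 1) ∈ 𝓝 β :=
      Metric.isOpen_ball.mem_nhds (by simpa using hβ)
    filter_upwards [eventually_not_isNonposInt β, nhdsWithin_le_nhds hball] with b hb hb'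
    exact (hurwitzBranchAux_eq hθ hs1 (by simpa using hb') hb).symm
  · exact hurwitzBranch_eq hθ hs1 hβ hn

theorem exists_disc (θ : ℕ →₀ ℝ) (α : ℂ) :
    ∃ K : ℕ, ‖α‖ < (K : ℝ) + 1 ∧ ∀ n, K < n → θ n = 0 := by
  obtain ⟨N, hN⟩ := exists_nat_ge ‖α‖
  refine ⟨max N (θ.support.sup id), ?_, fun n hn => ?_⟩
  · have : (N : ℝ) ≤ (max N (θ.support.sup id) : ℕ) := by exact_mod_cast le_max_left _ _
    linarith
  · by_contra h
    have h1 : n ≤ θ.support.sup id := Finset.le_sup (f := id) (Finsupp.mem_support_iff.2 h)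
    have := le_max_right N (θ.support.sup id)
    omega

theorem exists_offCuts (α : ℂ) : ∃ θ : ℕ →₀ ℝ, (∀ n, |θ n| < Real.pi) ∧ OffCuts θ α := by
  obtain ⟨N, hN⟩ := exists_nat_ge ‖α‖
  by_cases him : α.im = 0
  -- For real `α` the first cuts are turned to point straight down, off the real axis; for `n > N`
  -- already `Re (n + α) > 0`.
  · refine ⟨Finsupp.indicator (Finset.range (N + 1)) fun _ _ => Real.pi / 2, fun n => ?_,
      fun n => ?_⟩
    · rw [Finsupp.indicator_apply]
      split_ifs
      · rw [abs_of_pos (by positivity)]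
        linarith [Real.pi_pos]
      · simpa using Real.pi_pos
    · rw [Finsupp.indicator_apply]
      split_ifs with h
      · refine or_iff_not_imp_left.2 fun h0 => Or.inr ?_
        have e : Complex.exp (-(((Real.pi / 2 : ℝ) : ℂ) * Complex.I)) = -Complex.I := by
          push_cast
          rw [Complex.exp_neg, Complex.exp_pi_div_two_mul_I, Complex.inv_I]
        rw [e]
        intro hc
        apply h0
        refine Complex.ext ?_ (by simp [him])
        simp at hc ⊢
        linarith
      · refine Or.inr (Or.inl ?_)
        have hn : (N : ℝ) + 1 ≤ n := by
          have := not_lt.1 fun h' => h (Finset.mem_range.2 h')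
          exact_mod_cast this
        have := neg_le_of_abs_le (Complex.abs_re_le_norm α)
        simp
        linarith
  · refine ⟨0, by simpa using Real.pi_pos, fun n => Or.inr (Or.inr ?_)⟩
    simpa using him

theorem hurwitzBranchDeriv_eq {θ : ℕ →₀ ℝ} {K : ℕ} (hθ : ∀ n, K < n → θ n = 0)
    (r : ℕ) {s β : ℂ} (hs : s ≠ 1) (hβ : ‖β‖ < (K : ℝ) + 1) (hn : ¬ IsNonposInt β) :
    hurwitzBranchDeriv θ r s β =
      iteratedDeriv r (fun w => riemannZeta w + hurwitzReg θ K w β) s := by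
  refine Filter.EventuallyEq.iteratedDeriv_eq r ?_
  filter_upwards [isOpen_ne.mem_nhds hs] with w hw
  exact hurwitzBranch_eq hθ hw hβ hn

theorem hurwitzBranchDeriv_eq_of_re_neg {θ : ℕ →₀ ℝ} {K : ℕ} (hθ : ∀ n, K < n → θ n = 0)
    (r : ℕ) {s β : ℂ} (hs : s.re < 0) (hβ : ‖β‖ < (K : ℝ) + 1)
    (hn : OffCuts θ β ∨ ¬ IsNonposInt β) :
    hurwitzBranchDeriv θ r s β =
      iteratedDeriv r riemannZeta s + iteratedDeriv r (fun w => hurwitzReg θ K w β) s := by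
  have hs1 : s ≠ 1 := fun h => by norm_num [h] at hs
  have h : hurwitzBranchDeriv θ r s β =
      iteratedDeriv r (fun w => riemannZeta w + hurwitzReg θ K w β) s := by
    rcases hn with hn | hn
    · refine Filter.EventuallyEq.iteratedDeriv_eq r ?_
      filter_upwards [(isOpen_lt Complex.continuous_re continuous_const).mem_nhds hs] with w hw
      exact hurwitzBranch_eq_of_re_neg hθ hw hβ hn
    · exact hurwitzBranchDeriv_eq hθ r hs1 hβ hn
  rw [h, iteratedDeriv_fun_add _ (differentiable_hurwitzReg θ K hβ).contDiff.contDiffAt]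
  exact (analyticAt_riemannZeta hs1).contDiffAt

theorem continuousAt_hurwitzBranchDeriv {θ : ℕ →₀ ℝ} (r : ℕ) {s α : ℂ} (hs : s.re < 0)
    (hα : OffCuts θ α) : ContinuousAt (fun β => hurwitzBranchDeriv θ r s β) α := by
  obtain ⟨K, hK, hθ⟩ := exists_disc θ α
  have h := (continuousAt_const (y := iteratedDeriv r riemannZeta s)).fun_add
    (continuousAt_iteratedDeriv_hurwitzReg θ K r hs hα hK)
  refine h.congr ?_
  have hball : Metric.ball (0 : ℂ) ((K : ℝ) + 1) ∈ 𝓝 α :=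
    Metric.isOpen_ball.mem_nhds (by simpa using hK)
  -- If `α = -n`, points on a cut lie arbitrarily close to `α`; for them the formula holds because
  -- they are not nonpositive integers.
  have hev := eventually_nhdsWithin_iff.1 (eventually_not_isNonposInt α)
  filter_upwards [hball, hev] with β hβ hne
  refine (hurwitzBranchDeriv_eq_of_re_neg hθ r hs (by simpa using hβ) ?_).symm
  by_cases h : β = α
  · exact Or.inl (h ▸ hα)
  · exact Or.inr (hne h)

/-! ### Values at `0` and `1` -/

theorem branchLog_of_pos {θ : ℝ} (hθ : |θ| < Real.pi) {x : ℝ} (hx : 0 < x) :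
    branchLog θ x = Complex.log x := by
  rw [branchLog, Complex.log_ofReal_mul hx (Complex.exp_ne_zero _), Complex.log_exp]
  · rw [Complex.ofReal_log hx.le]
    ring
  · simp
    linarith [lt_of_abs_lt hθ]
  · simp
    linarith [neg_lt_of_abs_lt hθ]

theorem exp_neg_mul_branchLog_natCast_add_one {θ : ℝ} (hθ : |θ| < Real.pi) (s : ℂ) (n : ℕ) :
    Complex.exp (-s * branchLog θ ((n : ℂ) + 1)) = ((n : ℂ) + 1) ^ (-s) := by
  have h := branchLog_of_pos hθ (x := (n : ℝ) + 1) (by positivity)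
  push_cast at h
  rw [h, Complex.cpow_def_of_ne_zero (Nat.cast_add_one_ne_zero n), mul_comm]

theorem not_isNonposInt_one : ¬ IsNonposInt 1 := by
  rintro ⟨n, h⟩
  have := congrArg Complex.re h
  simp at this
  linarith [n.cast_nonneg (α := ℝ)]

theorem hurwitzBranch_one {θ : ℕ →₀ ℝ} (hθ : ∀ n, |θ n| < Real.pi) {s : ℂ} (hs : s ≠ 1) :
    hurwitzBranch θ s 1 = riemannZeta s := by
  have hζ : IsHurwitzContinuation θ 1 riemannZeta := by
    refine ⟨fun s hs => (differentiableAt_riemannZeta hs).differentiableWithinAt, fun s hs => ?_⟩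
    simpa only [exp_neg_mul_branchLog_natCast_add_one (hθ _)] using hasSum_riemannZeta hs
  have h : ∃ F : ℂ → ℂ, IsHurwitzContinuation θ 1 F := ⟨_, hζ⟩
  rw [hurwitzBranch, if_neg not_isNonposInt_one, hurwitzBranchAux, dif_pos h]
  exact h.choose_spec.eqOn hζ hs

theorem offCuts_zero {θ : ℕ →₀ ℝ} (hθ : ∀ n, |θ n| < Real.pi) : OffCuts θ 0 := by
  intro n
  rcases Nat.eq_zero_or_pos n with rfl | hn
  · simp
  · right
    have h : Complex.exp (-(θ n * Complex.I)) ∈ Complex.slitPlane := by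
      rw [Complex.mem_slitPlane_iff_arg]
      refine ⟨?_, Complex.exp_ne_zero _⟩
      have h1 := abs_lt.1 (hθ n)
      rw [← neg_mul, ← Complex.ofReal_neg, Complex.arg_exp_mul_I,
        (toIocMod_eq_self _).2 ⟨by linarith, by linarith⟩]
      intro h
      linarith
    have hn' : (0 : ℝ) < n := by exact_mod_cast hn
    rw [Complex.mem_slitPlane_iff] at h ⊢
    rw [add_zero, ← Complex.ofReal_natCast, Complex.re_ofReal_mul, Complex.im_ofReal_mul]
    exact h.imp (mul_pos hn') (mul_ne_zero hn'.ne')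

/-- The power with `n = 0` vanishes in the limit, the next `K` cancel `zetaHead K`, and the shift
series is zero at `β = 0`. -/
theorem hurwitzBranch_zero {θ : ℕ →₀ ℝ} (hθ : ∀ n, |θ n| < Real.pi) {s : ℂ} (hs : s.re < 0) :
    hurwitzBranch θ s 0 = riemannZeta s := by
  obtain ⟨K, hK, hθK⟩ := exists_disc θ 0
  rw [hurwitzBranch_eq_of_re_neg hθK hs hK (offCuts_zero hθ), hurwitzReg, Finset.sum_range_succ',
    zetaHead]
  have h : ∀ n : ℕ, branchPow (θ (n + 1)) 0 s (((n + 1 : ℕ) : ℂ) + 0) = ((n : ℂ) + 1) ^ (-s) :=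
    fun n => by
    rw [add_zero, Nat.cast_succ, branchPow_zero_of_ne _ _ (Nat.cast_add_one_ne_zero n),
      exp_neg_mul_branchLog_natCast_add_one (hθ _)]
  simp only [h]
  simp [branchPow, shiftSeries]

/-! ### Derivatives in the second variable and the coefficients -/

theorem iteratedDeriv_id_mul {g : ℂ → ℂ} {s : ℂ} (hg : AnalyticAt ℂ g s) (r : ℕ) :
    iteratedDeriv r (fun w => w * g w) s =
      s * iteratedDeriv r g s + r * iteratedDeriv (r - 1) g s := by
  induction r generalizing g with
  | zero => simp
  | succ r ih =>
    have hd : deriv (fun w => w * g w) =ᶠ[𝓝 s] fun w => g w + w * deriv g w := by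
      filter_upwards [hg.eventually_analyticAt] with w hw
      simpa using ((hasDerivAt_id' w).fun_mul hw.differentiableAt.hasDerivAt).deriv
    have hg' := hg.deriv
    have hm : AnalyticAt ℂ (fun w => w * deriv g w) s := analyticAt_id.mul hg'
    rw [iteratedDeriv_succ', hd.iteratedDeriv_eq,
      iteratedDeriv_fun_add hg.contDiffAt hm.contDiffAt, ih hg', iteratedDeriv_succ']
    rcases r with _ | r
    · simp
      ring
    · simp only [Nat.add_sub_cancel, iteratedDeriv_succ' (n := r)]
      push_cast
      ring

/-- `s * ζ(s + 1, β)` with the singularity at `s = 0` removed, for `‖β‖ < K + 1`. -/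
noncomputable def shiftedReg (θ : ℕ →₀ ℝ) (K : ℕ) (s β : ℂ) : ℂ :=
  zetaEntire (s + 1) + s * hurwitzReg θ K (s + 1) β

theorem differentiable_shiftedReg (θ : ℕ →₀ ℝ) (K : ℕ) {β : ℂ} (hβ : ‖β‖ < (K : ℝ) + 1) :
    Differentiable ℂ (fun s => shiftedReg θ K s β) := by
  have h1 : Differentiable ℂ (fun s => zetaEntire (s + 1)) :=
    differentiable_zetaEntire.comp (differentiable_id.add_const 1)
  have h2 : Differentiable ℂ (fun s => hurwitzReg θ K (s + 1) β) :=
    (differentiable_hurwitzReg θ K hβ).comp (differentiable_id.add_const 1)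
  exact h1.fun_add (differentiable_id.mul h2)

theorem continuousOn_shiftedReg (θ : ℕ →₀ ℝ) (K : ℕ) :
    ContinuousOn (fun p : ℂ × ℂ => shiftedReg θ K p.1 p.2) (Set.univ ×ˢ regularDisc θ K) := by
  have hZ := differentiable_zetaEntire.continuous
  have hc : ContinuousOn (fun p : ℂ × ℂ => hurwitzReg θ K (p.1 + 1) p.2)
      (Set.univ ×ˢ regularDisc θ K) :=
    (continuousOn_hurwitzReg θ K).comp (f := fun p : ℂ × ℂ => (p.1 + 1, p.2))
      (by fun_prop) fun p hp => ⟨Set.mem_univ _, hp.2⟩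
  unfold shiftedReg
  fun_prop

/-- The family is closed under differentiation in `β`, so the second derivative in claim 4 needs no
new estimate. -/
theorem hasDerivAt_shiftedReg (θ : ℕ →₀ ℝ) (K : ℕ) (s : ℂ) {β : ℂ} (hβ : β ∈ regularDisc θ K) :
    HasDerivAt (shiftedReg θ K s) (-(s * shiftedReg θ K (s + 1) β)) β := by
  have h := ((hasDerivAt_hurwitzReg θ K (s + 1) hβ).const_mul s).const_add (zetaEntire (s + 1))
  convert! h using 1
  rw [shiftedReg]
  ring

theorem shiftedReg_eq {θ : ℕ →₀ ℝ} {K : ℕ} (hθ : ∀ n, K < n → θ n = 0)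
    {s β : ℂ} (hs : s ≠ 0) (hβ : ‖β‖ < (K : ℝ) + 1) (hn : ¬ IsNonposInt β) :
    shiftedReg θ K s β = s * hurwitzBranch θ (s + 1) β := by
  have h1 : s + 1 ≠ 1 := by simpa using hs
  rw [hurwitzBranch_eq hθ h1 hβ hn, shiftedReg, zetaEntire_of_ne h1]
  ring

theorem shiftedHurwitz_eq {θ : ℕ →₀ ℝ} {K : ℕ} (hθ : ∀ n, K < n → θ n = 0)
    {β : ℂ} (hβ : ‖β‖ < (K : ℝ) + 1) (hn : ¬ IsNonposInt β) :
    shiftedHurwitz θ β = fun s => shiftedReg θ K s β := by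
  funext s
  rw [shiftedHurwitz]
  rcases eq_or_ne s 0 with rfl | hs
  · rw [Function.update_self]
    refine Tendsto.limUnder_eq ?_
    refine ((differentiable_shiftedReg θ K hβ).continuous.tendsto 0).mono_left
      nhdsWithin_le_nhds |>.congr' ?_
    filter_upwards [self_mem_nhdsWithin] with s hs
    exact shiftedReg_eq hθ hs hβ hn
  · rw [Function.update_of_ne hs, shiftedReg_eq hθ hs hβ hn]

theorem OffCuts.eventually_mem_regularDisc {θ : ℕ →₀ ℝ} {K : ℕ} {α : ℂ} (hc : OffCuts θ α)
    (hα : ¬ IsNonposInt α) (hK : ‖α‖ < (K : ℝ) + 1) : ∀ᶠ β in 𝓝 α, β ∈ regularDisc θ K :=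
  (isOpen_regularDisc θ K).mem_nhds (hc.mem_regularDisc hα hK)

/-- Common source of claims 2 and 3: since `shiftedHurwitz` is filled at its singularity, `s = 0` is
included. -/
theorem hasDerivAt_hurwitzBranchDeriv {θ : ℕ →₀ ℝ} (r : ℕ) {s α : ℂ} (hs : s ≠ 1)
    (hα : ¬ IsNonposInt α) (hc : OffCuts θ α) :
    HasDerivAt (fun β => hurwitzBranchDeriv θ r s β)
      (-iteratedDeriv r (shiftedHurwitz θ α) s) α := by
  obtain ⟨K, hK, hθ⟩ := exists_disc θ α
  have h := hasDerivAt_iteratedDeriv_param (U := {1}ᶜ) (V := regularDisc θ K)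
    (F := fun w β => riemannZeta w + hurwitzReg θ K w β) (D := fun w β => -shiftedReg θ K w β)
    isOpen_compl_singleton (isOpen_regularDisc θ K)
    (fun β hβ w hw => ((differentiableAt_riemannZeta hw).add (differentiable_hurwitzReg θ K
      (norm_lt_of_mem_regularDisc hβ) w)).differentiableWithinAt)
    (fun w _ β hβ => (hasDerivAt_hurwitzReg θ K w hβ).const_add _)
    ((continuousOn_shiftedReg θ K).neg.mono (Set.prod_mono_left (Set.subset_univ _)))
    r hs (hc.mem_regularDisc hα hK)
  rw [iteratedDeriv_fun_neg, ← shiftedHurwitz_eq hθ hK hα] at h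
  refine h.congr_of_eventuallyEq ?_
  filter_upwards [hc.eventually_mem_regularDisc hα hK] with β hβ
  exact hurwitzBranchDeriv_eq hθ r hs (norm_lt_of_mem_regularDisc hβ)
    (not_isNonposInt_of_mem_regularDisc hβ)

theorem hasDerivAt_iteratedDeriv_shiftedHurwitz {θ : ℕ →₀ ℝ} (r : ℕ) {α : ℂ}
    (hα : ¬ IsNonposInt α) (hc : OffCuts θ α) :
    HasDerivAt (fun β => iteratedDeriv r (shiftedHurwitz θ β) 0)
      (-iteratedDeriv r (fun s => s * (s + 1) * hurwitzBranch θ (s + 2) α) 0) α := by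
  obtain ⟨K, hK, hθ⟩ := exists_disc θ α
  have hcont : ContinuousOn (fun p : ℂ × ℂ => -(p.1 * shiftedReg θ K (p.1 + 1) p.2))
      (Set.univ ×ˢ regularDisc θ K) := by
    have := (continuousOn_shiftedReg θ K).comp (s := Set.univ ×ˢ regularDisc θ K)
      (f := fun p : ℂ × ℂ => (p.1 + 1, p.2)) (by fun_prop) fun p hp => ⟨Set.mem_univ _, hp.2⟩
    exact (continuousOn_fst.mul this).neg
  have h := hasDerivAt_iteratedDeriv_param (U := Set.univ) (V := regularDisc θ K)
    (F := shiftedReg θ K) (D := fun w β => -(w * shiftedReg θ K (w + 1) β))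
    isOpen_univ (isOpen_regularDisc θ K)
    (fun β hβ => (differentiable_shiftedReg θ K
      (norm_lt_of_mem_regularDisc hβ)).differentiableOn)
    (fun w _ β hβ => hasDerivAt_shiftedReg θ K w hβ) hcont
    r (Set.mem_univ 0) (hc.mem_regularDisc hα hK)
  have he : (fun s => s * (s + 1) * hurwitzBranch θ (s + 2) α) =ᶠ[𝓝 0]
      fun w => w * shiftedReg θ K (w + 1) α := by
    -- At `w = -1` the value `ζ(1, α)` is arbitrary; a neighbourhood of `0` avoids it.
    filter_upwards [isOpen_ne.mem_nhds (show (0 : ℂ) ≠ -1 by norm_num)] with w hw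
    have hw' : w + 1 ≠ 0 := fun h => hw (by linear_combination h)
    rw [shiftedReg_eq hθ hw' hK hα, show w + 1 + 1 = w + 2 by ring]
    ring
  rw [iteratedDeriv_fun_neg, ← he.iteratedDeriv_eq] at h
  refine h.congr_of_eventuallyEq ?_
  filter_upwards [hc.eventually_mem_regularDisc hα hK] with β hβ
  rw [shiftedHurwitz_eq hθ (norm_lt_of_mem_regularDisc hβ) (not_isNonposInt_of_mem_regularDisc hβ)]

theorem hasSum_hurwitzGamma (θ : ℕ →₀ ℝ) {α : ℂ} (hα : ¬ IsNonposInt α) {s : ℂ} (hs : s ≠ 0) :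
    HasSum (fun n : ℕ => hurwitzGamma θ n α * s ^ n) (s * hurwitzBranch θ (s + 1) α) := by
  obtain ⟨K, hK, hθ⟩ := exists_disc θ α
  have h := Complex.hasSum_taylorSeries_of_entire (differentiable_shiftedReg θ K hK) 0 s
  rw [shiftedReg_eq hθ hs hK hα, ← shiftedHurwitz_eq hθ hK hα] at h
  convert! h using 1
  funext n
  simp only [hurwitzGamma, smul_eq_mul, sub_zero]
  ring

theorem hurwitzGamma_zero (θ : ℕ →₀ ℝ) {α : ℂ} (hα : ¬ IsNonposInt α) :
    hurwitzGamma θ 0 α = 1 := by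
  obtain ⟨K, hK, hθ⟩ := exists_disc θ α
  rw [hurwitzGamma, shiftedHurwitz_eq hθ hK hα]
  simp [shiftedReg, zetaEntire_one]

theorem iteratedDeriv_shiftedHurwitz {θ : ℕ →₀ ℝ} (r : ℕ) {s α : ℂ} (hs : s ≠ 0)
    (hα : ¬ IsNonposInt α) :
    iteratedDeriv r (shiftedHurwitz θ α) s =
      s * hurwitzBranchDeriv θ r (s + 1) α + r * hurwitzBranchDeriv θ (r - 1) (s + 1) α := by
  obtain ⟨K, hK, hθ⟩ := exists_disc θ α
  have he : shiftedHurwitz θ α =ᶠ[𝓝 s] fun w => w * hurwitzBranch θ (w + 1) α := by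
    filter_upwards [isOpen_ne.mem_nhds hs] with w hw
    exact Function.update_of_ne hw _ _
  have han : AnalyticAt ℂ (fun w => hurwitzBranch θ (w + 1) α) s := by
    have h1 : AnalyticAt ℂ (fun w => w⁻¹ * shiftedReg θ K w α) s :=
      (analyticAt_inv hs).mul ((differentiable_shiftedReg θ K hK).analyticAt s)
    refine h1.congr ?_
    filter_upwards [isOpen_ne.mem_nhds hs] with w hw
    rw [shiftedReg_eq hθ hw hK hα, inv_mul_cancel_left₀ hw]
  rw [he.iteratedDeriv_eq, iteratedDeriv_id_mul han]
  have hs1 : ∀ m, iteratedDeriv m (fun w => hurwitzBranch θ (w + 1) α) s =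
      hurwitzBranchDeriv θ m (s + 1) α := fun m =>
    congrFun (iteratedDeriv_comp_add_const m (fun w => hurwitzBranch θ w α) 1) s
  rw [hs1, hs1]

theorem hurwitzBranchDeriv_zero_and_one {θ : ℕ →₀ ℝ} (hθ : ∀ n, |θ n| < Real.pi) (r : ℕ) {s : ℂ}
    (hs : s.re < 0) : hurwitzBranchDeriv θ r s 0 = iteratedDeriv r riemannZeta s ∧
      iteratedDeriv r riemannZeta s = hurwitzBranchDeriv θ r s 1 := by
  have hev := (isOpen_lt Complex.continuous_re continuous_const).mem_nhds hs
  constructor <;> refine Filter.EventuallyEq.iteratedDeriv_eq r ?_ <;> filter_upwards [hev] with w hw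
  · exact hurwitzBranch_zero hθ hw
  · have hw : w.re < 0 := hw
    exact (hurwitzBranch_one hθ fun h => by norm_num [h] at hw).symm

theorem hasDerivAt_hurwitzBranchDeriv_zero {θ : ℕ →₀ ℝ} (r : ℕ) {α : ℂ} (hα : ¬ IsNonposInt α)
    (hc : OffCuts θ α) : HasDerivAt (fun β => hurwitzBranchDeriv θ r 0 β)
      (-(r.factorial : ℂ) * hurwitzGamma θ r α) α := by
  have hr : (r.factorial : ℂ) ≠ 0 := by exact_mod_cast r.factorial_ne_zero
  have h := hasDerivAt_hurwitzBranchDeriv r zero_ne_one hα hc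
  convert! h using 1
  rw [hurwitzGamma]
  field_simp

/-- Infinitely many open conditions reduce to finitely many: for `n > K` the branch is principal and
`Re (n + β) > 0` on the whole disc. -/
theorem OffCuts.eventually {θ : ℕ →₀ ℝ} {α : ℂ} (hc : OffCuts θ α) (hα : ¬ IsNonposInt α) :
    ∀ᶠ β in 𝓝 α, ¬ IsNonposInt β ∧ OffCuts θ β := by
  obtain ⟨K, hK, hθ⟩ := exists_disc θ α
  filter_upwards [hc.eventually_mem_regularDisc hα hK] with β hβ
  refine ⟨not_isNonposInt_of_mem_regularDisc hβ, fun n => Or.inr ?_⟩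
  rcases lt_or_ge K n with hn | hn
  · have h1 := norm_lt_of_mem_regularDisc hβ
    have h2 := neg_le_of_abs_le (Complex.abs_re_le_norm β)
    have h3 : (K : ℝ) + 1 ≤ n := by exact_mod_cast hn
    rw [hθ n hn]
    left
    simp
    linarith
  · exact mem_slitPlane_of_mem_regularDisc hβ (Finset.mem_range.2 (by omega))

/-! ### The proposition -/

theorem mainTheorem1 :
    -- every point of the plane is reached by branches that are real on the positive axis
    (∀ α : ℂ, ∃ θ : ℕ →₀ ℝ, (∀ n, |θ n| < Real.pi) ∧ OffCuts θ α) ∧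
    ∀ θ : ℕ →₀ ℝ,
      -- the analytic continuation in `s` exists
      (∀ α : ℂ, ¬ IsNonposInt α → IsHurwitzContinuation θ α (fun s => hurwitzBranch θ s α)) ∧
      -- continuity in `α`, including at `0, -1, -2, …`
      (∀ (r : ℕ) (s : ℂ), s.re < 0 → ∀ α : ℂ, OffCuts θ α →
        ContinuousAt (fun β => hurwitzBranchDeriv θ r s β) α) ∧
      -- 1)
      ((∀ n, |θ n| < Real.pi) → ∀ r : ℕ,
        (∀ s : ℂ, s.re < 0 →
          hurwitzBranchDeriv θ r s 0 = iteratedDeriv r riemannZeta s ∧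
          iteratedDeriv r riemannZeta s = hurwitzBranchDeriv θ r s 1) ∧
        Tendsto (fun t : ℝ => hurwitzBranchDeriv θ r (t : ℂ) 0) (𝓝[<] (0 : ℝ))
          (𝓝 (iteratedDeriv r riemannZeta 0))) ∧
      -- 2); for `r = 0` the first term on the right is zero
      (∀ (r : ℕ) (s α : ℂ), s ≠ 0 → s ≠ 1 → ¬ IsNonposInt α → OffCuts θ α →
        HasDerivAt (fun β => hurwitzBranchDeriv θ r s β)
          (-(r : ℂ) * hurwitzBranchDeriv θ (r - 1) (s + 1) α
            - s * hurwitzBranchDeriv θ r (s + 1) α) α) ∧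
      -- the expansion that defines the coefficients `γ_{n-1}(α)`
      (∀ α : ℂ, ¬ IsNonposInt α → hurwitzGamma θ 0 α = 1 ∧
        ∀ s : ℂ, s ≠ 0 →
          HasSum (fun n : ℕ => hurwitzGamma θ n α * s ^ n) (s * hurwitzBranch θ (s + 1) α)) ∧
      -- 3)
      (∀ (r : ℕ) (α : ℂ), ¬ IsNonposInt α → OffCuts θ α →
        HasDerivAt (fun β => hurwitzBranchDeriv θ r 0 β)
          (-(r.factorial : ℂ) * hurwitzGamma θ r α) α) ∧
      -- 4), with the second derivative of `ζ^{(r)}(0, α)`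
      (∀ (r : ℕ) (α : ℂ), ¬ IsNonposInt α → OffCuts θ α →
        HasDerivAt (fun β => hurwitzGamma θ r β)
          (-(1 / (r.factorial : ℂ)) *
            iteratedDeriv r (fun s => s * (s + 1) * hurwitzBranch θ (s + 2) α) 0) α ∧
        HasDerivAt (deriv (fun β => hurwitzBranchDeriv θ r 0 β))
          (iteratedDeriv r (fun s => s * (s + 1) * hurwitzBranch θ (s + 2) α) 0) α) := by
  refine ⟨exists_offCuts, fun θ => ⟨fun α hα => ?_, fun r s hs α hα =>
    continuousAt_hurwitzBranchDeriv r hs hα, fun hθ r => ⟨fun s hs => ?_, ?_⟩,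
    fun r s α hs0 hs1 hα hc => ?_, fun α hα => ⟨hurwitzGamma_zero θ hα, fun s hs =>
    hasSum_hurwitzGamma θ hα hs⟩, fun r α hα hc => ?_, fun r α hα hc => ?_⟩⟩
  · obtain ⟨K, hK, hθ⟩ := exists_disc θ α
    have h := isHurwitzContinuation_riemannZeta_add hθ hK hα
    refine ⟨h.1.congr fun s hs => hurwitzBranch_eq hθ hs hK hα, fun s hs => ?_⟩
    have hs1 : s ≠ 1 := fun h1 => by simp [h1] at hs
    simpa only [hurwitzBranch_eq hθ hs1 hK hα] using h.2 s hs
  · exact hurwitzBranchDeriv_zero_and_one hθ r hs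
  · have han := analyticAt_riemannZeta (zero_ne_one (α := ℂ))
    have hc : ContinuousAt (iteratedDeriv r riemannZeta) ((0 : ℝ) : ℂ) := by
      rw [Complex.ofReal_zero, iteratedDeriv_eq_iterate]
      exact (han.iterated_deriv r).continuousAt
    have ht : Tendsto (fun t : ℝ => iteratedDeriv r riemannZeta t) (𝓝[<] 0)
        (𝓝 (iteratedDeriv r riemannZeta 0)) := by
      have h := (hc.comp (f := fun t : ℝ => (t : ℂ)) Complex.continuous_ofReal.continuousAt).tendsto
      simpa [Function.comp_def] using h.mono_left nhdsWithin_le_nhds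
    refine ht.congr' ?_
    filter_upwards [self_mem_nhdsWithin] with t ht
    exact (hurwitzBranchDeriv_zero_and_one hθ r (by simpa using ht)).1.symm
  · have h := hasDerivAt_hurwitzBranchDeriv r hs1 hα hc
    convert! h using 1
    rw [iteratedDeriv_shiftedHurwitz r hs0 hα]
    ring
  · exact hasDerivAt_hurwitzBranchDeriv_zero r hα hc
  · have hr : (r.factorial : ℂ) ≠ 0 := by exact_mod_cast r.factorial_ne_zero
    have hγ : HasDerivAt (fun β => hurwitzGamma θ r β) (-(1 / (r.factorial : ℂ)) *
        iteratedDeriv r (fun s => s * (s + 1) * hurwitzBranch θ (s + 2) α) 0) α := by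
      have h := (hasDerivAt_iteratedDeriv_shiftedHurwitz r hα hc).div_const (r.factorial : ℂ)
      convert! h using 1
      ring
    refine ⟨hγ, ?_⟩
    -- By claim 3 the first derivative equals `-r! * hurwitzGamma θ r` on a neighbourhood of `α`, so
    -- it inherits the derivative of the latter.
    have h := hγ.const_mul (-(r.factorial : ℂ))
    rw [← mul_assoc, neg_mul_neg, mul_one_div_cancel hr, one_mul] at h
    refine h.congr_of_eventuallyEq ?_
    filter_upwards [hc.eventually hα] with β hβ
    exact (hasDerivAt_hurwitzBranchDeriv_zero r hβ.1 hβ.2).deriv
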